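/- Let $K$ be a field. A finite directed graph $E=(E^0,E^1,s,r)$ consists of a finite set $E^0$ of vertices, a finite set $E^1$ of edges, and source and range maps $s,r:E^1\to E^0$; the out-degree of $v\in E^0$ is $|s^{-1}(v)|$, and $E$ is connected if any two vertices are joined by a walk that may traverse edges in either direction. For each $e\in E^1$ let $e^*$ be a formal symbol with $s(e^*)=r(e)$, $r(e^*)=s(e)$, put $(E^1)^*=\{e^*: e\in E^1\}$, and put $s(v)=r(v)=v$ for $v\in E^0$. The Leavitt inverse semigroup $LI(E)$ is the semigroup with zero generated by $E^0\cup E^1\cup (E^1)^*$ subject to the relations (1) $s(x)x=x\,r(x)=x$ for all $x\in E^0\cup E^1\cup (E^1)^*$; (2) $uv=0$ for $u\ne v$ in $E^0$; (3) $e^*f=0$ for $e\neq f$ in $E^1$; (4) $e^*e=r(e)$ for $e\in E^1$; (5) $s(e)=ee^*$ for each $e\in E^1$ such that $s(e)$ has out-degree $1$. The Leavitt path algebra $L_K(E)$ is the associative $K$-algebra generated by $E^0\cup E^1\cup (E^1)^*$ subject to (1)--(4) and (6) $w=\sum_{e\in E^1,\ s(e)=w} ee^*$ for each $w\in E^0$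 of nonzero out-degree. For a path $p=e_1\cdots e_n$ (where $r(e_i)=s(e_{i+1})$) write $|p|=n$, $r(p)=r(e_n)$ and $p^*=e_n^*\cdots e_1^*$; a vertex $v$ is a path of length $0$ with $r(v)=v=v^*$. Both objects are $\mathbb Z$-graded: for $i\in\mathbb Z$, the component $L_K(E)_i$ is the linear span of all $pq^*$, and $LI(E)_i$ consists of $0$ and all $pq^*$, where $p,q$ are paths with $r(p)=r(q)$ and $|p|-|q|=i$. A graded isomorphism is an isomorphism that maps the component of degree $i$ into the component of degree $i$ for every $i\in\mathbb Z$. Corollary. Let $E$ and $F$ be connected finite directed graphs all of whose vertices have out-degree at most $1$, and suppose that each of $E$ and $F$ has a cycle of length $1$ (an edge $e$ with $s(e)=r(e)$). Then the following five statements are equivalent: (1) $L_K(E)\cong_{\mathrm{gr}} L_K(F)$ as $\mathbb Z$-graded $K$-algebras; (2) $L_K(E)\cong L_K(F)$ as $K$-algebras; (3) $LI(E)\cong LI(F)$ as semigroups; (4) $LI(E)\cong_{\mathrm{gr}} LI(F)$ as $\mathbb Z$-graded semigroups; (5) $|E^0|=|F^0|$. -/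

import Mathlib

/-!
A directed graph `E` is a quiver on its type of vertices `V`. An edge of `E` is an element `e` of
`Quiver.Total V`, with source `e.left` and range `e.right`. A path is a `Quiver.Path`
(the path `Quiver.Path.nil : Quiver.Path v v` is the vertex `v`, of length `0`).
-/

namespace Leavitt

universe u v u' v' w

section Graphs

variable (V : Type u) [Quiver.{v} V]

variable {V} in
/-- The out-degree of a vertex: the number of edges with source `a`. -/
noncomputable def outDegree (a : V) : ℕ∞ := {e : Quiver.Total V | e.left = a}.encard

/-- A graph is connected if any two vertices are joined by a walk, that is, by a path in which
each edge is read in the positive or in the negative direction. -/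
def IsConnected : Prop :=
  ∀ a b : V, Nonempty (Quiver.Path (V := Quiver.Symmetrify V) a b)

/-- The graph has a cycle of length `1`, that is, an edge whose source and range coincide. -/
def HasLoop : Prop := ∃ e : Quiver.Total V, e.left = e.right

/-- The generators `E⁰ ∪ E¹ ∪ (E¹)*`. -/
inductive Gen : Type (max u v) where
  | vertex (a : V) : Gen
  | edge (e : Quiver.Total V) : Gen
  | ghost (e : Quiver.Total V) : Gen

variable {V}

/-- The source of a generator: `s(v) = v` and `s(e*) = r(e)`. -/
def Gen.source : Gen V → V
  | .vertex a => a
  | .edge e => e.left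
  | .ghost e => e.right

/-- The range of a generator: `r(v) = v` and `r(e*) = s(e)`. -/
def Gen.range : Gen V → V
  | .vertex a => a
  | .edge e => e.right
  | .ghost e => e.left

/-- The element `e₁ e₂ ⋯ eₙ` determined by a path, for an assignment `g` of elements of `M` to the
generators; the path of length `0` at `a` gives the vertex `a`. -/
def pathElt {M : Type*} [Mul M] (g : Gen V → M) : {a b : V} → Quiver.Path a b → M
  | a, _, .nil => g (.vertex a)
  | _, _, .cons p e => pathElt g p * g (.edge ⟨_, _, e⟩)

/-- The element `eₙ* ⋯ e₂* e₁*` determined by a path `e₁ e₂ ⋯ eₙ`; the path of length `0` at `a`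
gives the vertex `a`. -/
def ghostPathElt {M : Type*} [Mul M] (g : Gen V → M) : {a b : V} → Quiver.Path a b → M
  | a, _, .nil => g (.vertex a)
  | _, _, .cons p e => g (.ghost ⟨_, _, e⟩) * ghostPathElt g p

/-- The elements `p q*` with `p`, `q` paths such that `r(p) = r(q)` and `|p| - |q| = i`. -/
def monomialsOfDegree {M : Type*} [Mul M] (g : Gen V → M) (i : ℤ) : Set M :=
  {x | ∃ (a b c : V) (p : Quiver.Path a c) (q : Quiver.Path b c),
    (p.length : ℤ) - (q.length : ℤ) = i ∧ x = pathElt g p * ghostPathElt g q}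

/-- The defining relations shared by the Leavitt inverse semigroup and the Leavitt path algebra,
for an assignment `g` of elements of `M` to the generators. -/
inductive CommonRel {M : Type*} [Mul M] [Zero M] (g : Gen V → M) : M → M → Prop
  | source_mul (x : Gen V) : CommonRel g (g (.vertex x.source) * g x) (g x)
  | mul_range (x : Gen V) : CommonRel g (g x * g (.vertex x.range)) (g x)
  | vertex_mul_vertex (a b : V) (h : a ≠ b) : CommonRel g (g (.vertex a) * g (.vertex b)) 0
  | ghost_mul_edge_of_ne (e f : Quiver.Total V) (h : e ≠ f) :
      CommonRel g (g (.ghost e) * g (.edge f)) 0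
  | ghost_mul_edge (e : Quiver.Total V) :
      CommonRel g (g (.ghost e) * g (.edge e)) (g (.vertex e.right))

end Graphs

section InverseSemigroup

variable (V : Type u) [Quiver.{v} V]

/-- The free semigroup with zero on the generators. -/
abbrev FreeLI : Type (max u v) := WithZero (FreeSemigroup (Gen V))

variable {V} in
/-- A generator as an element of the free semigroup with zero. -/
def FreeLI.gen (x : Gen V) : FreeLI V := ((FreeSemigroup.of x : FreeSemigroup (Gen V)) : FreeLI V)

/-- The defining relations of the Leavitt inverse semigroup. -/
inductive LIRel : FreeLI V → FreeLI V → Prop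
  | common (x y : FreeLI V) (h : CommonRel FreeLI.gen x y) : LIRel x y
  | edge_mul_ghost (e : Quiver.Total V) (h : outDegree e.left = 1) :
      LIRel (FreeLI.gen (.vertex e.left)) (FreeLI.gen (.edge e) * FreeLI.gen (.ghost e))

/-- The Leavitt inverse semigroup `LI(E)`: the semigroup with zero generated by
`E⁰ ∪ E¹ ∪ (E¹)*` subject to the defining relations. -/
def LI : Type (max u v) := (conGen (LIRel V)).Quotient

namespace LI

instance : Semigroup (LI V) := inferInstanceAs (Semigroup (conGen (LIRel V)).Quotient)

/-- The canonical map from the free semigroup with zero. -/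
def mk : FreeLI V → LI V := fun x => ((x : FreeLI V) : (conGen (LIRel V)).Quotient)

instance : SemigroupWithZero (LI V) where
  zero := mk V 0
  zero_mul x := Quotient.inductionOn' x fun y => congrArg (mk V) (zero_mul y)
  mul_zero x := Quotient.inductionOn' x fun y => congrArg (mk V) (mul_zero y)

variable {V} in
/-- A generator as an element of `LI(E)`. -/
def gen (x : Gen V) : LI V := mk V (FreeLI.gen x)

/-- The component of degree `i` of the `ℤ`-graded semigroup `LI(E)`: zero together with the
elements `p q*` of degree `|p| - |q| = i`. -/
def component (i : ℤ) : Set (LI V) := {0} ∪ monomialsOfDegree gen i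

end LI

/-- `LI(E) ≅ LI(F)` as semigroups. -/
def LIIso (V : Type u) [Quiver.{v} V] (W : Type u') [Quiver.{v'} W] : Prop :=
  Nonempty (LI V ≃* LI W)

/-- `LI(E) ≅ LI(F)` as `ℤ`-graded semigroups. -/
def LIGradedIso (V : Type u) [Quiver.{v} V] (W : Type u') [Quiver.{v'} W] : Prop :=
  ∃ φ : LI V ≃* LI W, ∀ i : ℤ, ∀ x ∈ LI.component V i, φ x ∈ LI.component W i

end InverseSemigroup

noncomputable section PathAlgebra

variable (K : Type w) [Field K] (V : Type u) [Quiver.{v} V]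

/-- The free associative (not necessarily unital) `K`-algebra on the generators: the semigroup
algebra of the free semigroup. -/
abbrev FreeLPA : Type (max w u v) := MonoidAlgebra K (FreeSemigroup (Gen V))

variable {V} in
/-- A generator as an element of the free associative algebra. -/
def FreeLPA.gen (x : Gen V) : FreeLPA K V :=
  MonoidAlgebra.single (FreeSemigroup.of x) 1

/-- The defining relations of the Leavitt path algebra. In a finite graph every out-degree is
finite, and the last relation is imposed at each vertex that is not a sink. -/
inductive LPARel : FreeLPA K V → FreeLPA K V → Prop
  | common (x y : FreeLPA K V) (h : CommonRel (FreeLPA.gen K) x y) : LPARel x y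
  | vertex_eq_sum (a : V) (h0 : outDegree a ≠ 0) (hfin : outDegree a ≠ ⊤) :
      LPARel (FreeLPA.gen K (.vertex a))
        (∑ᶠ e ∈ {e : Quiver.Total V | e.left = a},
          FreeLPA.gen K (.edge e) * FreeLPA.gen K (.ghost e))

/-- The two-sided ideal (closed under scalar multiplication) generated by the relations. -/
def LPAIdeal : Submodule K (FreeLPA K V) :=
  sInf {I | (∀ x y, LPARel K V x y → x - y ∈ I) ∧ ∀ a, ∀ x ∈ I, a * x ∈ I ∧ x * a ∈ I}

theorem mul_mem_LPAIdeal (a : FreeLPA K V) {x : FreeLPA K V} (hx : x ∈ LPAIdeal K V) :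
    a * x ∈ LPAIdeal K V := by
  rw [LPAIdeal, Submodule.mem_sInf] at hx ⊢
  exact fun I hI => (hI.2 a x (hx I hI)).1

theorem LPAIdeal_mul_mem (a : FreeLPA K V) {x : FreeLPA K V} (hx : x ∈ LPAIdeal K V) :
    x * a ∈ LPAIdeal K V := by
  rw [LPAIdeal, Submodule.mem_sInf] at hx ⊢
  exact fun I hI => (hI.2 a x (hx I hI)).2

/-- The Leavitt path algebra `L_K(E)`. -/
def LPA : Type (max w u v) := FreeLPA K V ⧸ LPAIdeal K V

namespace LPA

instance : AddCommGroup (LPA K V) := inferInstanceAs (AddCommGroup (FreeLPA K V ⧸ LPAIdeal K V))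

instance : Module K (LPA K V) := inferInstanceAs (Module K (FreeLPA K V ⧸ LPAIdeal K V))

/-- The canonical map from the free associative algebra. -/
def mk : FreeLPA K V →ₗ[K] LPA K V := (LPAIdeal K V).mkQ

theorem mk_surjective : Function.Surjective (mk K V) := (LPAIdeal K V).mkQ_surjective

theorem mk_eq_mk {x y : FreeLPA K V} : mk K V x = mk K V y ↔ x - y ∈ LPAIdeal K V :=
  Submodule.Quotient.eq (LPAIdeal K V)

/-- The multiplication of `L_K(E)`, induced by that of the free associative algebra. -/
instance : Mul (LPA K V) where
  mul := Quotient.map₂ (fun x y : FreeLPA K V => x * y) <| by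
    intro a b hab c d hcd
    rw [← Quotient.eq_iff_equiv] at hab hcd ⊢
    refine (mk_eq_mk K V).2 ?_
    have h1 := LPAIdeal_mul_mem K V c ((mk_eq_mk K V).1 hab)
    have h2 := mul_mem_LPAIdeal K V b ((mk_eq_mk K V).1 hcd)
    have h3 := add_mem h1 h2
    rwa [sub_mul, mul_sub, sub_add_sub_cancel] at h3

theorem mk_mul (x y : FreeLPA K V) : mk K V (x * y) = mk K V x * mk K V y := rfl

instance : NonUnitalRing (LPA K V) where
  left_distrib x y z := by
    obtain ⟨x, rfl⟩ := mk_surjective K V x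
    obtain ⟨y, rfl⟩ := mk_surjective K V y
    obtain ⟨z, rfl⟩ := mk_surjective K V z
    rw [← map_add, ← mk_mul, ← mk_mul, ← mk_mul, ← map_add, mul_add]
  right_distrib x y z := by
    obtain ⟨x, rfl⟩ := mk_surjective K V x
    obtain ⟨y, rfl⟩ := mk_surjective K V y
    obtain ⟨z, rfl⟩ := mk_surjective K V z
    rw [← map_add, ← mk_mul, ← mk_mul, ← mk_mul, ← map_add, add_mul]
  zero_mul x := by
    obtain ⟨x, rfl⟩ := mk_surjective K V x
    rw [← map_zero (mk K V), ← mk_mul, zero_mul]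
  mul_zero x := by
    obtain ⟨x, rfl⟩ := mk_surjective K V x
    rw [← map_zero (mk K V), ← mk_mul, mul_zero]
  mul_assoc x y z := by
    obtain ⟨x, rfl⟩ := mk_surjective K V x
    obtain ⟨y, rfl⟩ := mk_surjective K V y
    obtain ⟨z, rfl⟩ := mk_surjective K V z
    rw [← mk_mul, ← mk_mul, ← mk_mul, ← mk_mul, mul_assoc]

instance : IsScalarTower K (LPA K V) (LPA K V) where
  smul_assoc c x y := by
    obtain ⟨x, rfl⟩ := mk_surjective K V x
    obtain ⟨y, rfl⟩ := mk_surjective K V y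
    simp only [smul_eq_mul, ← map_smul, ← mk_mul, smul_mul_assoc]

instance : SMulCommClass K (LPA K V) (LPA K V) where
  smul_comm c x y := by
    obtain ⟨x, rfl⟩ := mk_surjective K V x
    obtain ⟨y, rfl⟩ := mk_surjective K V y
    simp only [smul_eq_mul, ← map_smul, ← mk_mul, mul_smul_comm]

variable {V} in
/-- A generator as an element of `L_K(E)`. -/
def gen (x : Gen V) : LPA K V := mk K V (FreeLPA.gen K x)

/-- The homogeneous component of degree `i` of `L_K(E)`: the linear span of the elements `p q*`
with `|p| - |q| = i`. -/
def component (i : ℤ) : Submodule K (LPA K V) := Submodule.span K (monomialsOfDegree (gen K) i)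

end LPA

/-- `L_K(E) ≅ L_K(F)` as `K`-algebras. (A bijective multiplicative linear map also preserves the
identity elements `∑ v`, which exist for finite graphs.) -/
def LPAIso (K : Type w) [Field K] (V : Type u) [Quiver.{v} V] (W : Type u') [Quiver.{v'} W] :
    Prop :=
  ∃ φ : LPA K V →ₙₐ[K] LPA K W, Function.Bijective φ

/-- `L_K(E) ≅ L_K(F)` as `ℤ`-graded `K`-algebras. -/
def LPAGradedIso (K : Type w) [Field K] (V : Type u) [Quiver.{v} V]
    (W : Type u') [Quiver.{v'} W] : Prop :=
  ∃ φ : LPA K V →ₙₐ[K] LPA K W, Function.Bijective φ ∧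
    ∀ i : ℤ, ∀ x ∈ LPA.component K V i, φ x ∈ LPA.component K W i

end PathAlgebra

end Leavitt

/-! Connectedness, out-degree at most one and a loop force every vertex to emit exactly one edge and
every forward walk to end at the loop. Relation (6) then has a single summand and coincides with
relation (5), so both objects have the same monomial calculus. Since `e e* = s(e)`, prolonging `p`
and `q` by the same edge does not change `p q*`; hence `p q*` depends only on its two starting
vertices `a`, `b` and its degree `i`. Call it `u(a,i,b)` (`LoopGraph.unit`). Because the cycle has
length one, it exists for all `a`, `i`, `b`, and `u(a,i,b) u(b,j,c) = u(a,i+j,c)`, while products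
with different middle vertices vanish: these are the monomial matrix units of `n × n` matrices over
`K[x,x⁻¹]`, with `n` the number of vertices.

This description refers to the graph only through its vertex set, and every generator is such a
unit, so a bijection of vertices induces graded isomorphisms of both objects
(`IsLeavittFamily.transport`, `map_unit`).

Conversely both objects determine `n`. The idempotents of `LI(E)` are `0` and the `n` vertices. For
the algebra, setting `x = 1` gives a nonzero representation by `n × n` matrices, and a nonzero
representation by `m × m` matrices contains `n²` independent matrix units, so `n ≤ m`; an
isomorphism gives both inequalities. -/

namespace Leavitt

universe u v u' v' w

/-! ### Graphs of out-degree one that flow into a loop -/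

section LoopGraph

variable {V : Type u} [Quiver.{v} V]

/-- A graph all of whose vertices emit exactly one edge `out a`, and in which every vertex is
joined by a path to a fixed vertex `root`, whose edge is a loop. -/
structure LoopGraph (V : Type u) [Quiver.{v} V] where
  /-- The edge emitted by a vertex. -/
  out : V → Quiver.Total V
  left_out : ∀ a, (out a).left = a
  out_left : ∀ e, out e.left = e
  /-- The vertex of the loop. -/
  root : V
  right_out_root : (out root).right = root
  reach : ∀ a, ∃ k, (fun b => (out b).right)^[k] a = root

/-- The property "a forward path leads to the loop" passes along an undirected walk starting at the
loop. Against an edge this is clear; along an edge it holds because that edge is the only way to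
leave its source. -/
theorem nonempty_loopGraph (hc : IsConnected V) (hd : ∀ a : V, outDegree a ≤ 1)
    (hl : HasLoop V) : Nonempty (LoopGraph V) := by
  obtain ⟨l, hl⟩ := hl
  have huniq : ∀ e f : Quiver.Total V, e.left = f.left → e = f := fun e f h =>
    Set.encard_le_one_iff.1 (hd f.left) e f h rfl
  let r : V → V → Prop := fun a b => ∃ e : Quiver.Total V, e.left = a ∧ e.right = b
  have hforward : ∀ {a b : V}, (a ⟶ b) → Relation.ReflTransGen r a l.left →
      Relation.ReflTransGen r b l.left := by
    intro a b e h
    -- Either the path is empty, and the edge is the loop itself, or its first step is this very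
    -- edge.
    rcases h.cases_head with h | ⟨x, ⟨f, hf, hx⟩, h⟩
    · obtain rfl : (⟨a, b, e⟩ : Quiver.Total V) = l := huniq _ _ h
      exact (show b = a from hl.symm) ▸ Relation.ReflTransGen.refl
    · obtain rfl : f = ⟨a, b, e⟩ := huniq _ _ hf
      subst hx
      exact h
  have hreach : ∀ a : V, Relation.ReflTransGen r a l.left := by
    intro a
    obtain ⟨p⟩ := hc l.left a
    induction p with
    | nil => exact .refl
    | cons p e ih =>
      rcases e with e | e
      · exact hforward e ih
      · exact .head ⟨⟨_, _, e⟩, rfl, rfl⟩ ih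
  have hout : ∀ a : V, ∃ e : Quiver.Total V, e.left = a := by
    intro a
    rcases (hreach a).cases_head with h | ⟨x, ⟨f, hf, hx⟩, h⟩
    · exact ⟨l, h.symm⟩
    · exact ⟨f, hf⟩
  choose out hout using hout
  have hol : ∀ e, out e.left = e := fun e => huniq _ _ (hout _)
  refine ⟨⟨out, hout, hol, l.left, by rw [hol, hl], fun a => ?_⟩⟩
  induction hreach a using Relation.ReflTransGen.head_induction_on with
  | refl => exact ⟨0, rfl⟩
  | head h _ ih =>
    obtain ⟨e, rfl, rfl⟩ := h
    obtain ⟨k, hk⟩ := ih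
    exact ⟨k + 1, by rwa [Function.iterate_succ_apply, hol]⟩

namespace LoopGraph

variable (G : LoopGraph V)

/-- The range of the edge emitted by a vertex. -/
def next (a : V) : V := (G.out a).right

theorem next_left (e : Quiver.Total V) : G.next e.left = e.right := by
  rw [next, G.out_left]

theorem outDegree_eq_one (G : LoopGraph V) (a : V) : outDegree a = 1 := by
  rw [outDegree, Set.encard_eq_one]
  refine ⟨G.out a, Set.ext fun e => ⟨?_, ?_⟩⟩
  · rintro rfl
    exact (G.out_left e).symm
  · rintro rfl
    exact G.left_out a

theorem left_injective (G : LoopGraph V) {e f : Quiver.Total V} (h : e.left = f.left) : e = f := by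
  rw [← G.out_left e, h, G.out_left]

theorem exists_iterate_next_eq_root (a : V) : ∃ k, ∀ m, G.next^[k + m] a = G.root := by
  obtain ⟨k, hk⟩ := G.reach a
  refine ⟨k, fun m => ?_⟩
  rw [add_comm, Function.iterate_add_apply]
  change G.next^[k] a = G.root at hk
  rw [hk]
  exact Function.iterate_fixed G.right_out_root m

theorem exists_iterate_next_eq (a : V) (i : ℤ) (b : V) :
    ∃ kl : ℕ × ℕ, (kl.1 : ℤ) - kl.2 = i ∧ G.next^[kl.1] a = G.next^[kl.2] b := by
  obtain ⟨k, hk⟩ := G.exists_iterate_next_eq_root a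
  obtain ⟨l, hl⟩ := G.exists_iterate_next_eq_root b
  -- Both lengths are large enough to reach the root, where the loop absorbs any surplus; their
  -- difference is `i.toNat - (-i).toNat = i`.
  refine ⟨(k + (l + i.toNat), l + (k + (-i).toNat)), ?_, (hk _).trans (hl _).symm⟩
  push_cast
  omega

theorem exists_path (a : V) (k : ℕ) :
    ∃ p : Quiver.Path a (G.next^[k] a), p.length = k := by
  induction k with
  | zero => exact ⟨.nil, rfl⟩
  | succ k ih =>
    obtain ⟨p, hp⟩ := ih
    rw [Function.iterate_succ_apply']
    generalize G.next^[k] a = b at p hp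
    have e : b ⟶ G.next b := cast (by rw [next, G.left_out]) (G.out b).hom
    exact ⟨p.cons e, by simp [hp]⟩

theorem iterate_next_length {a b : V} (p : Quiver.Path a b) : G.next^[p.length] a = b := by
  induction p with
  | nil => rfl
  | cons p e ih =>
    rw [Quiver.Path.length_cons, Function.iterate_succ_apply', ih]
    exact G.next_left ⟨_, _, e⟩

end LoopGraph

/-- The degree of a generator. -/
def Gen.degree : Gen V → ℤ
  | .vertex _ => 0
  | .edge _ => 1
  | .ghost _ => -1

/-! ### Leavitt families and their monomials -/

variable {M : Type*} [SemigroupWithZero M]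

/-- An assignment of elements of `M` to the generators that satisfies the relations of the Leavitt
inverse semigroup of a graph all of whose out-degrees are `1`. -/
structure IsLeavittFamily (g : Gen V → M) : Prop where
  common : ∀ x y, CommonRel g x y → x = y
  edge_mul_ghost : ∀ e, g (.edge e) * g (.ghost e) = g (.vertex e.left)

theorem CommonRel.map_eq {N : Type*} [Mul N] [Zero N] {g : Gen V → N} {x y : N}
    (h : CommonRel g x y) {g' : Gen V → M} (hg : ∀ x y, CommonRel g' x y → x = y) (f : N →ₙ* M)
    (h0 : f 0 = 0) (hf : ∀ x, f (g x) = g' x) : f x = f y := by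
  apply hg
  cases h with
  | source_mul x => simpa [hf] using CommonRel.source_mul x
  | mul_range x => simpa [hf] using CommonRel.mul_range x
  | vertex_mul_vertex a b h => simpa [hf, h0] using CommonRel.vertex_mul_vertex a b h
  | ghost_mul_edge_of_ne e f h => simpa [hf, h0] using CommonRel.ghost_mul_edge_of_ne e f h
  | ghost_mul_edge e => simpa [hf] using CommonRel.ghost_mul_edge e

namespace LoopGraph

variable (G : LoopGraph V) (g : Gen V → M)

/-- The product of the first `k` edges emitted from `a`. -/
def fwd (a : V) : ℕ → M
  | 0 => g (.vertex a)
  | k + 1 => fwd a k * g (.edge (G.out (G.next^[k] a)))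

/-- The product, in reverse order, of the ghosts of the first `k` edges emitted from `a`. -/
def bwd (a : V) : ℕ → M
  | 0 => g (.vertex a)
  | k + 1 => g (.ghost (G.out (G.next^[k] a))) * bwd a k

/-- The element `p q*` of degree `i` with `p` starting at `a` and `q` starting at `b`. -/
noncomputable def unit (a : V) (i : ℤ) (b : V) : M :=
  G.fwd g a (G.exists_iterate_next_eq a i b).choose.1 *
    G.bwd g b (G.exists_iterate_next_eq a i b).choose.2

/-- With one edge out of each vertex, a path is determined by its start and its length. -/
theorem pathElt_eq_fwd {a b : V} (p : Quiver.Path a b) : pathElt g p = G.fwd g a p.length := by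
  induction p with
  | nil => simp [pathElt, fwd]
  | cons p e ih =>
    rw [pathElt, Quiver.Path.length_cons, fwd, ih, G.iterate_next_length, ← G.out_left ⟨_, _, e⟩]

theorem ghostPathElt_eq_bwd {a b : V} (p : Quiver.Path a b) :
    ghostPathElt g p = G.bwd g a p.length := by
  induction p with
  | nil => simp [ghostPathElt, bwd]
  | cons p e ih =>
    rw [ghostPathElt, Quiver.Path.length_cons, bwd, ih, G.iterate_next_length,
      ← G.out_left ⟨_, _, e⟩]

end LoopGraph

end LoopGraph

/-! ### Calculus of the units and its transport between graphs -/

section Units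

variable {V : Type u} [Quiver.{v} V] {M : Type*} [SemigroupWithZero M]

namespace IsLeavittFamily

variable {g : Gen V → M} (hg : IsLeavittFamily g) (G : LoopGraph V)

include hg

theorem source_mul (x : Gen V) : g (.vertex x.source) * g x = g x :=
  hg.common _ _ (.source_mul x)

theorem mul_range (x : Gen V) : g x * g (.vertex x.range) = g x :=
  hg.common _ _ (.mul_range x)

theorem vertex_mul_self (a : V) : g (.vertex a) * g (.vertex a) = g (.vertex a) :=
  hg.source_mul (.vertex a)

theorem vertex_mul_vertex {a b : V} (h : a ≠ b) : g (.vertex a) * g (.vertex b) = 0 :=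
  hg.common _ _ (.vertex_mul_vertex a b h)

theorem fwd_mul_vertex (a : V) (k : ℕ) :
    G.fwd g a k * g (.vertex (G.next^[k] a)) = G.fwd g a k := by
  cases k with
  | zero => exact hg.vertex_mul_self a
  | succ k =>
    rw [LoopGraph.fwd, mul_assoc, Function.iterate_succ_apply']
    exact congrArg _ (hg.mul_range (.edge _))

theorem bwd_mul_fwd (a : V) (k : ℕ) :
    G.bwd g a k * G.fwd g a k = g (.vertex (G.next^[k] a)) := by
  induction k with
  | zero => exact hg.vertex_mul_self a
  | succ k ih =>
    set b := G.next^[k] a with hb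
    have h := hg.mul_range (.ghost (G.out b))
    rw [Gen.range, G.left_out] at h
    rw [LoopGraph.bwd, LoopGraph.fwd, mul_assoc, ← mul_assoc (G.bwd g a k), ih, ← mul_assoc, ← hb, h,
      Function.iterate_succ_apply']
    exact hg.common _ _ (.ghost_mul_edge _)

/-- The two walks have met, so each further step inserts the same `e e*` in the middle, which equals
the vertex `s(e)` and is absorbed. -/
theorem fwd_mul_bwd_add {a b : V} {k l : ℕ} (h : G.next^[k] a = G.next^[l] b) (m : ℕ) :
    G.fwd g a (k + m) * G.bwd g b (l + m) = G.fwd g a k * G.bwd g b l := by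
  induction m with
  | zero => rfl
  | succ m ih =>
    have h' : G.next^[k + m] a = G.next^[l + m] b := by
      rw [add_comm k, add_comm l, Function.iterate_add_apply, Function.iterate_add_apply, h]
    rw [← ih, ← add_assoc, ← add_assoc, LoopGraph.fwd, LoopGraph.bwd, mul_assoc,
      ← mul_assoc (g _) (g _), ← h', hg.edge_mul_ghost, G.left_out, ← mul_assoc, hg.fwd_mul_vertex]

/-- Makes the choice of lengths in `LoopGraph.unit` immaterial: two representations of the same
degree become equal after common prolongation. -/
theorem fwd_mul_bwd_eq_unit {a b : V} {k l : ℕ} (h : G.next^[k] a = G.next^[l] b) {i : ℤ}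
    (hi : (k : ℤ) - l = i) : G.fwd g a k * G.bwd g b l = G.unit g a i b := by
  obtain ⟨hi', h'⟩ := (G.exists_iterate_next_eq a i b).choose_spec
  rw [LoopGraph.unit]
  set kl := (G.exists_iterate_next_eq a i b).choose
  -- Each representation is prolonged by the forward length of the other; equality of degrees then
  -- matches the backward lengths.
  rw [← hg.fwd_mul_bwd_add G h kl.1, ← hg.fwd_mul_bwd_add G h' k, add_comm k,
    show l + kl.1 = kl.2 + k by omega]

theorem unit_mul_unit (a : V) (i : ℤ) (b : V) (j : ℤ) (c : V) :
    G.unit g a i b * G.unit g b j c = G.unit g a (i + j) c := by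
  obtain ⟨⟨k, l⟩, hi, h⟩ := G.exists_iterate_next_eq a i b
  obtain ⟨⟨k', l'⟩, hj, h'⟩ := G.exists_iterate_next_eq b j c
  dsimp only at hi h hj h'
  have key : G.next^[k + k'] a = G.next^[l' + l] c := by
    rw [add_comm k, Function.iterate_add_apply, h, ← Function.iterate_add_apply, add_comm,
      Function.iterate_add_apply, h', ← Function.iterate_add_apply, add_comm]
  -- Prolonging the first factor by `k'` and the second by `l` makes both inner paths the path of
  -- length `l + k'` from `b`, so they cancel to a vertex.
  rw [← hg.fwd_mul_bwd_eq_unit G h hi, ← hg.fwd_mul_bwd_eq_unit G h' hj,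
    ← hg.fwd_mul_bwd_add G h k', ← hg.fwd_mul_bwd_add G h' l, add_comm k' l, mul_assoc,
    ← mul_assoc (G.bwd g b _), hg.bwd_mul_fwd, ← mul_assoc,
    show G.next^[l + k'] b = G.next^[k + k'] a by
      rw [add_comm, Function.iterate_add_apply, ← h, ← Function.iterate_add_apply, add_comm],
    hg.fwd_mul_vertex]
  exact hg.fwd_mul_bwd_eq_unit G key (by push_cast; omega)

theorem unit_zero (a : V) : G.unit g a 0 a = g (.vertex a) := by
  rw [← hg.fwd_mul_bwd_eq_unit G (k := 0) (l := 0) rfl (by simp)]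
  exact hg.vertex_mul_self a

theorem vertex_mul_unit (a : V) (i : ℤ) (b : V) :
    g (.vertex a) * G.unit g a i b = G.unit g a i b := by
  rw [← hg.unit_zero G, hg.unit_mul_unit, zero_add]

theorem unit_mul_vertex (a : V) (i : ℤ) (b : V) :
    G.unit g a i b * g (.vertex b) = G.unit g a i b := by
  rw [← hg.unit_zero G, hg.unit_mul_unit, add_zero]

theorem unit_mul_unit_of_ne (a : V) (i : ℤ) {b b' : V} (h : b ≠ b') (j : ℤ) (c : V) :
    G.unit g a i b * G.unit g b' j c = 0 := by
  rw [← hg.unit_mul_vertex, ← hg.vertex_mul_unit G b', mul_assoc, ← mul_assoc (g _) (g _),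
    hg.vertex_mul_vertex h, zero_mul, mul_zero]

theorem unit_gen (x : Gen V) : G.unit g x.source x.degree x.range = g x := by
  cases x with
  | vertex a => exact hg.unit_zero G a
  | edge e =>
    rw [← hg.fwd_mul_bwd_eq_unit G (k := 1) (l := 0) (by exact G.next_left e) (by simp [Gen.degree])]
    simp only [LoopGraph.fwd, LoopGraph.bwd, Function.iterate_zero, id, Gen.source, G.out_left]
    rw [mul_assoc, show g (.edge e) * g (.vertex (Gen.range (.edge e))) = _ from
      hg.mul_range (.edge e)]
    exact hg.source_mul (.edge e)
  | ghost e =>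
    rw [← hg.fwd_mul_bwd_eq_unit G (k := 0) (l := 1) (by exact (G.next_left e).symm)
      (by simp [Gen.degree])]
    simp only [LoopGraph.fwd, LoopGraph.bwd, Function.iterate_zero, id, Gen.range, G.out_left]
    rw [← mul_assoc, hg.source_mul (.ghost e)]
    exact hg.mul_range (.ghost e)

theorem monomialsOfDegree_eq (i : ℤ) :
    monomialsOfDegree g i = {x | ∃ a b, x = G.unit g a i b} := by
  ext x
  constructor
  · rintro ⟨a, b, c, p, q, hi, rfl⟩
    refine ⟨a, b, ?_⟩
    rw [G.pathElt_eq_fwd, G.ghostPathElt_eq_bwd]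
    exact hg.fwd_mul_bwd_eq_unit G ((G.iterate_next_length p).trans (G.iterate_next_length q).symm)
      hi
  · rintro ⟨a, b, rfl⟩
    obtain ⟨⟨k, l⟩, hi, h⟩ := G.exists_iterate_next_eq a i b
    dsimp only at hi h
    obtain ⟨p, hp⟩ := G.exists_path a k
    have hq : ∃ q : Quiver.Path b (G.next^[k] a), q.length = l := h ▸ G.exists_path b l
    obtain ⟨q, hq⟩ := hq
    refine ⟨a, b, _, p, q, by rw [hp, hq, hi], ?_⟩
    rw [G.pathElt_eq_fwd, G.ghostPathElt_eq_bwd, hp, hq, hg.fwd_mul_bwd_eq_unit G h hi]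

end IsLeavittFamily

/-- The generators of `V` sent to the elements of `M` that correspond to them under a map `σ` of
vertices. -/
noncomputable def LoopGraph.transport {W : Type u'} [Quiver.{v'} W] (G : LoopGraph W)
    (g : Gen W → M) (σ : V → W) (x : Gen V) : M :=
  G.unit g (σ x.source) x.degree (σ x.range)

variable {W : Type u'} [Quiver.{v'} W]

/-- Each relation is an instance of the multiplication rule for units, with degrees adding up.
Injectivity of `σ` serves only the two zero relations; for edges it applies to sources, since
distinct edges have distinct sources. -/
theorem IsLeavittFamily.transport {g : Gen W → M} (hg : IsLeavittFamily g) (G : LoopGraph V)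
    (H : LoopGraph W) {σ : V → W} (hσ : Function.Injective σ) :
    IsLeavittFamily (H.transport g σ : Gen V → M) where
  common x y h := by
    cases h with
    | source_mul x => exact (hg.unit_mul_unit H ..).trans (by rw [Gen.degree, zero_add]; rfl)
    | mul_range x => exact (hg.unit_mul_unit H ..).trans (by cases x <;> rfl)
    | vertex_mul_vertex a b h => exact hg.unit_mul_unit_of_ne H _ _ (hσ.ne h) _ _
    | ghost_mul_edge_of_ne e f h =>
      exact hg.unit_mul_unit_of_ne H _ _ (hσ.ne fun h' => h (G.left_injective h')) _ _
    | ghost_mul_edge e => exact hg.unit_mul_unit H ..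
  edge_mul_ghost e := hg.unit_mul_unit H ..

theorem map_unit {N : Type*} [SemigroupWithZero N] {g : Gen V → M} {g' : Gen W → N}
    (hg' : IsLeavittFamily g')
    (G : LoopGraph V) (H : LoopGraph W) {σ : V → W} (f : M →ₙ* N)
    (hf : ∀ x, f (g x) = H.transport g' σ x) (a : V) (i : ℤ) (b : V) :
    f (G.unit g a i b) = H.unit g' (σ a) i (σ b) := by
  have hfwd : ∀ a k, f (G.fwd g a k) = H.unit g' (σ a) k (σ (G.next^[k] a)) := by
    intro a k
    induction k with
    | zero => exact hf _
    | succ k ih =>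
      rw [LoopGraph.fwd, map_mul, ih, hf, Function.iterate_succ_apply', LoopGraph.transport,
        Gen.source, G.left_out, hg'.unit_mul_unit]
      simp [Gen.degree, Gen.range, LoopGraph.next]
  have hbwd : ∀ a k, f (G.bwd g a k) = H.unit g' (σ (G.next^[k] a)) (-k) (σ a) := by
    intro a k
    induction k with
    | zero => exact hf _
    | succ k ih =>
      rw [LoopGraph.bwd, map_mul, ih, hf, Function.iterate_succ_apply', LoopGraph.transport,
        Gen.range, G.left_out, hg'.unit_mul_unit]
      simp [Gen.degree, Gen.source, LoopGraph.next, add_comm]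
  obtain ⟨hi, h⟩ := (G.exists_iterate_next_eq a i b).choose_spec
  rw [LoopGraph.unit, map_mul, hfwd, hbwd, h, hg'.unit_mul_unit, ← sub_eq_add_neg, hi]

open Classical in
/-- The representation of the generators by matrix units. -/
noncomputable def matrixGen (K : Type w) [Field K] (x : Gen V) : Matrix V V K :=
  Matrix.single x.source x.range 1

/-- This is the matrix picture with the degree variable set to `1`; it shows that the presentations
do not collapse. -/
theorem isLeavittFamily_matrixGen (K : Type w) [Field K] [Fintype V] (G : LoopGraph V) :
    IsLeavittFamily (matrixGen K : Gen V → Matrix V V K) where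
  common x y h := by
    classical
    cases h with
    | source_mul x => simp [matrixGen, Gen.source, Gen.range]
    | mul_range x => simp [matrixGen, Gen.source, Gen.range]
    | vertex_mul_vertex a b h => simp [matrixGen, Gen.source, Gen.range, h]
    | ghost_mul_edge_of_ne e f h =>
      exact Matrix.single_mul_single_of_ne _ _ _ _ (fun h' => h (G.left_injective h')) _
    | ghost_mul_edge e => simp [matrixGen, Gen.source, Gen.range]
  edge_mul_ghost e := by simp [matrixGen, Gen.source, Gen.range]

theorem matrixGen_vertex_ne_zero (K : Type w) [Field K] (a : V) :
    matrixGen K (.vertex a) ≠ 0 := by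
  classical
  intro h
  simpa [matrixGen, Gen.source, Gen.range] using congrFun (congrFun h a) a

end Units

/-! ### The Leavitt inverse semigroup and its idempotents -/

section InverseSemigroup

variable {V : Type u} [Quiver.{v} V] {M : Type*} [SemigroupWithZero M]

/-- The extension of an assignment of the generators to the free semigroup with zero. -/
def FreeLI.lift (g : Gen V → M) : FreeLI V →ₙ* M where
  toFun x := WithZero.recZeroCoe 0 (FreeSemigroup.lift g) x
  map_mul' x y := by
    induction x using WithZero.recZeroCoe with
    | zero => exact (zero_mul _).symm
    | coe x =>
      induction y using WithZero.recZeroCoe with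
      | zero => exact (mul_zero _).symm
      | coe y => exact map_mul (FreeSemigroup.lift g) x y

theorem FreeLI.lift_gen (g : Gen V → M) (x : Gen V) : FreeLI.lift g (FreeLI.gen x) = g x :=
  FreeSemigroup.lift_of g x

namespace LI

theorem mk_eq_mk {x y : FreeLI V} (h : LIRel V x y) : mk V x = mk V y :=
  (Con.eq _).2 (ConGen.Rel.of _ _ h)

theorem isLeavittFamily_gen (G : LoopGraph V) : IsLeavittFamily (gen : Gen V → LI V) where
  common x y h := by
    cases h with
    | source_mul x => exact mk_eq_mk (.common _ _ (.source_mul x))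
    | mul_range x => exact mk_eq_mk (.common _ _ (.mul_range x))
    | vertex_mul_vertex a b h => exact mk_eq_mk (.common _ _ (.vertex_mul_vertex a b h))
    | ghost_mul_edge_of_ne e f h => exact mk_eq_mk (.common _ _ (.ghost_mul_edge_of_ne e f h))
    | ghost_mul_edge e => exact mk_eq_mk (.common _ _ (.ghost_mul_edge e))
  edge_mul_ghost e := (mk_eq_mk (.edge_mul_ghost e (G.outDegree_eq_one _))).symm

@[elab_as_elim]
theorem induction {p : LI V → Prop} (zero : p 0) (gen : ∀ x, p (gen x))
    (mul : ∀ x y, p x → p y → p (x * y)) (x : LI V) : p x := by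
  obtain ⟨x, rfl⟩ : ∃ y, mk V y = x := Quotient.exists_rep x
  induction x using WithZero.recZeroCoe with
  | zero => exact zero
  | coe x =>
    induction x with
    | ih1 x => exact gen x
    | ih2 x y hx hy => exact mul _ _ hx hy

/-- The homomorphism from the Leavitt inverse semigroup given by a Leavitt family. -/
def lift {g : Gen V → M} (hg : IsLeavittFamily g) : LI V →ₙ* M where
  toFun x := Con.liftOn x (FreeLI.lift g) fun a b h => by
    have hle : conGen (LIRel V) ≤ Con.ker (FreeLI.lift g) := Con.conGen_le.2 fun x y h => by
      cases h with
      | common x y h => exact h.map_eq hg.common _ rfl (FreeLI.lift_gen g)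
      | edge_mul_ghost e h =>
        change FreeLI.lift g _ = FreeLI.lift g _
        rw [map_mul, FreeLI.lift_gen, FreeLI.lift_gen, FreeLI.lift_gen]
        exact (hg.edge_mul_ghost e).symm
    exact hle h
  map_mul' x y := by
    obtain ⟨x, rfl⟩ : ∃ z, mk V z = x := Quotient.exists_rep x
    obtain ⟨y, rfl⟩ : ∃ z, mk V z = y := Quotient.exists_rep y
    exact map_mul (FreeLI.lift g) x y

theorem lift_gen {g : Gen V → M} (hg : IsLeavittFamily g) (x : Gen V) : lift hg (gen x) = g x :=
  FreeLI.lift_gen g x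

theorem lift_zero {g : Gen V → M} (hg : IsLeavittFamily g) : lift hg 0 = 0 := rfl

theorem eq_zero_or_eq_unit (G : LoopGraph V) (x : LI V) :
    x = 0 ∨ ∃ a i b, x = G.unit gen a i b := by
  have hg := isLeavittFamily_gen G
  induction x using LI.induction with
  | zero => exact .inl rfl
  | gen x => exact .inr ⟨_, _, _, (hg.unit_gen G x).symm⟩
  | mul x y hx hy =>
    rcases hx with rfl | ⟨a, i, b, rfl⟩
    · exact .inl (zero_mul y)
    rcases hy with rfl | ⟨b', j, c, rfl⟩
    · exact .inl (mul_zero _)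
    by_cases h : b = b'
    · subst h
      exact .inr ⟨_, _, _, hg.unit_mul_unit G ..⟩
    · exact .inl (hg.unit_mul_unit_of_ne G _ _ h _ _)

theorem gen_vertex_ne_zero [Finite V] (G : LoopGraph V) (a : V) :
    (gen (.vertex a) : LI V) ≠ 0 := by
  have := Fintype.ofFinite V
  intro h
  have := congrArg (lift (isLeavittFamily_matrixGen ℚ G)) h
  rw [lift_gen, lift_zero] at this
  exact matrixGen_vertex_ne_zero ℚ a this

theorem isIdempotentElem_iff (G : LoopGraph V) (x : LI V) :
    IsIdempotentElem x ↔ x = 0 ∨ ∃ a, x = gen (.vertex a) := by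
  have hg := isLeavittFamily_gen G
  constructor
  · intro hx
    rcases eq_zero_or_eq_unit G x with h | ⟨a, i, b, rfl⟩
    · exact .inl h
    by_cases h : b = a
    · subst h
      -- Idempotency says `u(b,2i,b) = u(b,i,b)`; multiplication by `u(b,-i,b)` turns this into
      -- `u(b,i,b) = u(b,0,b)`, a vertex. No knowledge that different degrees give different
      -- elements is needed.
      have hx := congrArg (· * G.unit gen b (-i) b) hx.eq
      simp only [hg.unit_mul_unit, add_neg_cancel_right, add_neg_cancel] at hx
      exact .inr ⟨b, by rw [hx, hg.unit_zero]⟩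
    · exact .inl (hx.eq.symm.trans (hg.unit_mul_unit_of_ne G _ _ h _ _))
  · rintro (rfl | ⟨a, rfl⟩)
    · exact zero_mul _
    · exact hg.vertex_mul_self a

theorem gen_vertex_injective [Finite V] (G : LoopGraph V) :
    Function.Injective fun a => (gen (.vertex a) : LI V) := by
  have hg := isLeavittFamily_gen G
  intro a b h
  by_contra hab
  have h0 := hg.vertex_mul_vertex hab
  dsimp only at h
  rw [← h, hg.vertex_mul_self] at h0
  exact gen_vertex_ne_zero G a h0

/-- The idempotents of the Leavitt inverse semigroup are `0` and the vertices. -/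
noncomputable def optionEquivIdempotents [Finite V] (G : LoopGraph V) :
    Option V ≃ {x : LI V // IsIdempotentElem x} :=
  Equiv.ofBijective
    (fun a => ⟨a.elim 0 fun a => gen (.vertex a), (isIdempotentElem_iff G _).2 <| by
      cases a with
      | none => exact .inl rfl
      | some a => exact .inr ⟨a, rfl⟩⟩) <| by
    refine ⟨fun a b h => ?_, fun ⟨x, hx⟩ => ?_⟩
    · rw [Subtype.mk.injEq] at h
      cases a with
      | none =>
        cases b with
        | none => rfl
        | some b => exact absurd h.symm (gen_vertex_ne_zero G b)
      | some a =>
        cases b with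
        | none => exact absurd h (gen_vertex_ne_zero G a)
        | some b => exact congrArg some (gen_vertex_injective G h)
    · rcases (isIdempotentElem_iff G x).1 hx with rfl | ⟨a, rfl⟩
      · exact ⟨none, rfl⟩
      · exact ⟨some a, rfl⟩

theorem hom_ext {f f' : LI V →ₙ* M} (h0 : f 0 = f' 0) (h : ∀ x, f (gen x) = f' (gen x)) (x : LI V) :
    f x = f' x := by
  induction x using LI.induction with
  | zero => exact h0
  | gen x => exact h x
  | mul x y hx hy => rw [map_mul, map_mul, hx, hy]

variable {W : Type u'} [Quiver.{v'} W]

/-- The homomorphism of Leavitt inverse semigroups induced by an injection of vertices. -/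
noncomputable def map (G : LoopGraph V) (H : LoopGraph W) {σ : V → W}
    (hσ : Function.Injective σ) : LI V →ₙ* LI W :=
  lift ((isLeavittFamily_gen H).transport G H hσ)

theorem map_unit (G : LoopGraph V) (H : LoopGraph W) {σ : V → W} (hσ : Function.Injective σ)
    (a : V) (i : ℤ) (b : V) :
    map G H hσ (G.unit gen a i b) = H.unit gen (σ a) i (σ b) :=
  Leavitt.map_unit (isLeavittFamily_gen H) G H _ (lift_gen _) a i b

theorem map_map (G : LoopGraph V) (H : LoopGraph W) (σ : V ≃ W) (x : LI V) :
    map H G σ.symm.injective (map G H σ.injective x) = x := by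
  refine hom_ext (f := (map H G σ.symm.injective).comp (map G H σ.injective))
    (f' := MulHom.id _) rfl (fun x => ?_) x
  rw [← (isLeavittFamily_gen G).unit_gen G x]
  simp [map_unit]

end LI

variable {W : Type u'} [Quiver.{v'} W]

theorem LoopGraph.liGradedIso (G : LoopGraph V) (H : LoopGraph W) (σ : V ≃ W) :
    LIGradedIso V W := by
  refine ⟨{ LI.map G H σ.injective with
    invFun := LI.map H G σ.symm.injective
    left_inv := LI.map_map G H σ
    right_inv := LI.map_map H G σ.symm }, fun i x hx => ?_⟩
  rw [LI.component, (LI.isLeavittFamily_gen G).monomialsOfDegree_eq G] at hx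
  rw [LI.component, (LI.isLeavittFamily_gen H).monomialsOfDegree_eq H]
  rcases hx with rfl | ⟨a, b, rfl⟩
  · exact .inl rfl
  · exact .inr ⟨σ a, σ b, LI.map_unit G H σ.injective a i b⟩

theorem LoopGraph.card_eq_of_liIso [Finite V] [Finite W] (G : LoopGraph V) (H : LoopGraph W)
    (h : LIIso V W) : Nat.card V = Nat.card W := by
  obtain ⟨φ⟩ := h
  have e : {x : LI V // IsIdempotentElem x} ≃ {x : LI W // IsIdempotentElem x} :=
    φ.toEquiv.subtypeEquiv fun x => by
      rw [IsIdempotentElem, IsIdempotentElem, MulEquiv.toEquiv_eq_coe, EquivLike.coe_coe, ← map_mul,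
        φ.injective.eq_iff]
  -- The extra element of `Option` on each side is the zero idempotent.
  have := Nat.card_congr
    ((LI.optionEquivIdempotents G).trans (e.trans (LI.optionEquivIdempotents H).symm))
  rwa [Finite.card_option, Finite.card_option, Nat.add_right_cancel_iff] at this

end InverseSemigroup

/-! ### The Leavitt path algebra and its matrix representations -/

section PathAlgebra

variable {K : Type w} [Field K] {V : Type u} [Quiver.{v} V]

namespace LPA

/-- The canonical homomorphism from the free associative algebra. -/
noncomputable def mkHom (K : Type w) [Field K] (V : Type u) [Quiver.{v} V] :
    FreeLPA K V →ₙₐ[K] LPA K V where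
  toFun := mk K V
  map_smul' := (mk K V).map_smul
  map_zero' := (mk K V).map_zero
  map_add' := (mk K V).map_add
  map_mul' := mk_mul K V

theorem mk_eq_mk_of_rel {x y : FreeLPA K V} (h : LPARel K V x y) : mk K V x = mk K V y := by
  rw [mk_eq_mk, LPAIdeal, Submodule.mem_sInf]
  exact fun I hI => hI.1 x y h

end LPA

/-- Reduces relation (6) to `w = e e*` for the one edge `e` leaving `w`. -/
theorem LoopGraph.finsum_edges {A : Type*} [AddCommMonoid A] (G : LoopGraph V)
    (f : Quiver.Total V → A) (a : V) :
    ∑ᶠ e ∈ {e : Quiver.Total V | e.left = a}, f e = f (G.out a) := by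
  have : {e : Quiver.Total V | e.left = a} = {G.out a} := by
    ext e
    refine ⟨?_, ?_⟩
    · rintro rfl
      exact (G.out_left e).symm
    · rintro rfl
      exact G.left_out a
  rw [this, finsum_mem_singleton]

namespace LPA

theorem isLeavittFamily_gen (G : LoopGraph V) : IsLeavittFamily (gen K : Gen V → LPA K V) where
  common x y h := by
    cases h with
    | source_mul x => exact mk_eq_mk_of_rel (.common _ _ (.source_mul x))
    | mul_range x => exact mk_eq_mk_of_rel (.common _ _ (.mul_range x))
    | vertex_mul_vertex a b h =>
      exact (mk_eq_mk_of_rel (.common _ _ (.vertex_mul_vertex a b h))).trans (map_zero _)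
    | ghost_mul_edge_of_ne e f h =>
      exact (mk_eq_mk_of_rel (.common _ _ (.ghost_mul_edge_of_ne e f h))).trans (map_zero _)
    | ghost_mul_edge e => exact mk_eq_mk_of_rel (.common _ _ (.ghost_mul_edge e))
  edge_mul_ghost e := by
    have h := mk_eq_mk_of_rel (.vertex_eq_sum (K := K) e.left (by simp [G.outDegree_eq_one])
      (by simp [G.outDegree_eq_one]))
    rw [G.finsum_edges, G.out_left] at h
    exact h.symm

variable {A : Type*} [NonUnitalRing A] [Module K A]

theorem hom_ext {f f' : LPA K V →ₙₐ[K] A} (h : ∀ x, f (gen K x) = f' (gen K x)) : f = f' := by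
  have : f.comp (mkHom K V) = f'.comp (mkHom K V) :=
    MonoidAlgebra.nonUnitalAlgHom_ext' K (FreeSemigroup.hom_ext (funext h))
  ext x
  obtain ⟨x, rfl⟩ := mk_surjective K V x
  exact DFunLike.congr_fun this x

variable [IsScalarTower K A A] [SMulCommClass K A A]

/-- The homomorphism from the free associative algebra given by an assignment of the generators. -/
noncomputable def freeLift (g : Gen V → A) : FreeLPA K V →ₙₐ[K] A :=
  MonoidAlgebra.liftMagma K (FreeSemigroup.lift g)

theorem freeLift_gen (g : Gen V → A) (x : Gen V) :
    freeLift (K := K) g (FreeLPA.gen K x) = g x := by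
  simp [freeLift, FreeLPA.gen]

theorem ideal_le_ker (G : LoopGraph V) {g : Gen V → A} (hg : IsLeavittFamily g) {x : FreeLPA K V}
    (hx : x ∈ LPAIdeal K V) : freeLift (K := K) g x = 0 := by
  let f : FreeLPA K V →ₗ[K] A := ((freeLift g : FreeLPA K V →ₙₐ[K] A) : FreeLPA K V →ₗ[K] A)
  have hle : LPAIdeal K V ≤ LinearMap.ker f := by
    refine sInf_le ⟨fun x y h => ?_, fun a x hx => ?_⟩
    · rw [LinearMap.mem_ker, map_sub, sub_eq_zero]
      change freeLift (K := K) g x = freeLift (K := K) g y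
      cases h with
      | common x y h =>
        exact h.map_eq hg.common ((freeLift g : FreeLPA K V →ₙₐ[K] A) : FreeLPA K V →ₙ* A)
          (map_zero (freeLift (K := K) g)) (freeLift_gen g)
      | vertex_eq_sum a h0 hfin =>
        rw [G.finsum_edges, map_mul, freeLift_gen, freeLift_gen, freeLift_gen, hg.edge_mul_ghost,
          G.left_out]
    · change freeLift (K := K) g x = 0 at hx
      constructor
      · change freeLift (K := K) g (a * x) = 0
        rw [map_mul, hx, mul_zero]
      · change freeLift (K := K) g (x * a) = 0
        rw [map_mul, hx, zero_mul]
  exact hle hx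

/-- The homomorphism from the Leavitt path algebra given by a Leavitt family. -/
noncomputable def lift (G : LoopGraph V) {g : Gen V → A} (hg : IsLeavittFamily g) :
    LPA K V →ₙₐ[K] A :=
  let f : LPA K V →ₗ[K] A := (LPAIdeal K V).liftQ
    ((freeLift g : FreeLPA K V →ₙₐ[K] A) : FreeLPA K V →ₗ[K] A) fun _ => ideal_le_ker G hg
  { toFun := f
    map_smul' := f.map_smul
    map_zero' := f.map_zero
    map_add' := f.map_add
    map_mul' := fun x y => by
      obtain ⟨x, rfl⟩ := mk_surjective K V x
      obtain ⟨y, rfl⟩ := mk_surjective K V y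
      exact map_mul (freeLift (K := K) g) x y }

theorem lift_gen (G : LoopGraph V) {g : Gen V → A} (hg : IsLeavittFamily g) (x : Gen V) :
    lift (K := K) G hg (gen K x) = g x :=
  freeLift_gen g x

variable {W : Type u'} [Quiver.{v'} W]

/-- The homomorphism of Leavitt path algebras induced by an injection of vertices. -/
noncomputable def map (K : Type w) [Field K] (G : LoopGraph V) (H : LoopGraph W) {σ : V → W}
    (hσ : Function.Injective σ) : LPA K V →ₙₐ[K] LPA K W :=
  lift G ((isLeavittFamily_gen H).transport G H hσ)

theorem map_unit (G : LoopGraph V) (H : LoopGraph W) {σ : V → W} (hσ : Function.Injective σ)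
    (a : V) (i : ℤ) (b : V) :
    map K G H hσ (G.unit (gen K) a i b) = H.unit (gen K) (σ a) i (σ b) :=
  Leavitt.map_unit (isLeavittFamily_gen H) G H (map K G H hσ : LPA K V →ₙ* LPA K W)
    (lift_gen G ((isLeavittFamily_gen H).transport G H hσ)) a i b

theorem map_map (G : LoopGraph V) (H : LoopGraph W) (σ : V ≃ W) (x : LPA K V) :
    map K H G σ.symm.injective (map K G H σ.injective x) = x := by
  have : (map K H G σ.symm.injective).comp (map K G H σ.injective) =
      NonUnitalAlgHom.id K (LPA K V) := hom_ext fun x => by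
    rw [← (isLeavittFamily_gen G).unit_gen G x]
    simp [map_unit]
  exact DFunLike.congr_fun this x

end LPA

variable {W : Type u'} [Quiver.{v'} W]

theorem LoopGraph.lpaGradedIso (K : Type w) [Field K] (G : LoopGraph V) (H : LoopGraph W)
    (σ : V ≃ W) : LPAGradedIso K V W := by
  refine ⟨LPA.map K G H σ.injective, ⟨Function.LeftInverse.injective (LPA.map_map G H σ),
    Function.RightInverse.surjective (LPA.map_map H G σ.symm)⟩, fun i x hx => ?_⟩
  have hle : LPA.component K V i ≤ (LPA.component K W i).comap
      (LPA.map K G H σ.injective : LPA K V →ₗ[K] LPA K W) := by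
    refine Submodule.span_le.2 ?_
    rw [(LPA.isLeavittFamily_gen G).monomialsOfDegree_eq G]
    rintro _ ⟨a, b, rfl⟩
    refine Submodule.subset_span ?_
    rw [(LPA.isLeavittFamily_gen H).monomialsOfDegree_eq H]
    exact ⟨σ a, σ b, LPA.map_unit G H σ.injective a i b⟩
  exact hle hx

/-- The Leavitt path algebra of a graph with `n` vertices has no nonzero representation by matrices
of size less than `n`. -/
theorem LoopGraph.card_le_of_hom (G : LoopGraph V) [Fintype V] {n : Type*} [Fintype n]
    (ψ : LPA K V →ₙₐ[K] Matrix n n K) (hψ : ψ ≠ 0) : Fintype.card V ≤ Fintype.card n := by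
  classical
  have hg := LPA.isLeavittFamily_gen (K := K) G
  -- The units of degree `0` multiply like the `n²` matrix units indexed by pairs of vertices.
  let X : V × V → Matrix n n K := fun p => ψ (G.unit (LPA.gen K) p.1 0 p.2)
  have hmul : ∀ a b c, X (a, b) * X (b, c) = X (a, c) := fun a b c => by
    simp only [X, ← map_mul, hg.unit_mul_unit, add_zero]
  have hmul0 : ∀ a b b' c, b ≠ b' → X (a, b) * X (b', c) = 0 := fun a b b' c h => by
    simp only [X, ← map_mul, hg.unit_mul_unit_of_ne G _ _ h, map_zero]
  have hne : ∀ a, X (a, a) ≠ 0 := by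
    intro a ha
    refine hψ (LPA.hom_ext fun x => ?_)
    -- Every diagonal unit factors through `X (a, a)`, so the vanishing of one kills all vertices
    -- and hence all generators.
    have hx : X (x.source, x.source) = 0 := by
      rw [← hmul _ a, ← hmul _ a a, ha, mul_zero, zero_mul]
    rw [← hg.source_mul x, map_mul, ← hg.unit_zero G]
    change X (x.source, x.source) * _ = 0
    rw [hx, zero_mul]
  have hli : LinearIndependent K X := by
    rw [Fintype.linearIndependent_iff]
    rintro c hc ⟨a, b⟩
    -- Multiplying by `X (a, a)` on the left and `X (b, a)` on the right leaves only the `(a, b)`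
    -- term, as `c (a, b) • X (a, a)`.
    have h := congrArg (fun m => X (a, a) * m * X (b, a)) hc
    simp only [Finset.mul_sum, Finset.sum_mul, mul_zero, zero_mul] at h
    rw [Finset.sum_eq_single (a, b)] at h
    · rw [mul_smul_comm, smul_mul_assoc, hmul, hmul] at h
      exact (smul_eq_zero.1 h).resolve_right (hne a)
    · rintro ⟨a', b'⟩ - hab
      rw [mul_smul_comm, smul_mul_assoc]
      by_cases ha : a = a'
      · subst ha
        have hb : b' ≠ b := fun hb => hab (by rw [hb])
        rw [hmul, hmul0 _ _ _ _ hb, smul_zero]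
      · rw [hmul0 _ _ _ _ ha, zero_mul, smul_zero]
    · simp
  have := hli.fintype_card_le_finrank
  rw [Fintype.card_prod, Module.finrank_matrix, Module.finrank_self, mul_one] at this
  exact Nat.mul_self_le_mul_self_iff.1 this

theorem LoopGraph.card_le_of_surjective [Finite V] [Finite W] (G : LoopGraph V) (H : LoopGraph W)
    (φ : LPA K V →ₙₐ[K] LPA K W) (hφ : Function.Surjective φ) : Nat.card V ≤ Nat.card W := by
  have := Fintype.ofFinite V
  have := Fintype.ofFinite W
  rw [Nat.card_eq_fintype_card, Nat.card_eq_fintype_card]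
  -- The matrix representation of the target is pulled back along `φ`; it stays nonzero because a
  -- vertex of the target lies in the image.
  refine G.card_le_of_hom ((LPA.lift H (isLeavittFamily_matrixGen K H)).comp φ) fun h => ?_
  obtain ⟨x, hx⟩ := hφ (LPA.gen K (.vertex H.root))
  have h := DFunLike.congr_fun h x
  rw [NonUnitalAlgHom.comp_apply, hx, LPA.lift_gen] at h
  exact matrixGen_vertex_ne_zero K H.root h

theorem LoopGraph.card_eq_of_lpaIso [Finite V] [Finite W] (G : LoopGraph V) (H : LoopGraph W)
    (h : LPAIso K V W) : Nat.card V = Nat.card W := by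
  obtain ⟨φ, hφ⟩ := h
  refine (G.card_le_of_surjective H φ hφ.2).antisymm ?_
  obtain ⟨f, hfl, hfr⟩ := Function.bijective_iff_has_inverse.1 hφ
  exact H.card_le_of_surjective G (NonUnitalAlgHom.inverse φ f hfl hfr) hfl.surjective

end PathAlgebra

end Leavitt

theorem mainTheorem2 {K : Type*} [Field K]
    {E : Type*} [Quiver E] [Finite E] [Finite (Quiver.Total E)]
    {F : Type*} [Quiver F] [Finite F] [Finite (Quiver.Total F)]
    (hE : Leavitt.IsConnected E) (hF : Leavitt.IsConnected F)
    (hdE : ∀ a : E, Leavitt.outDegree a ≤ 1) (hdF : ∀ a : F, Leavitt.outDegree a ≤ 1)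
    (hlE : Leavitt.HasLoop E) (hlF : Leavitt.HasLoop F) :
    List.TFAE [
      Leavitt.LPAGradedIso K E F,
      Leavitt.LPAIso K E F,
      Leavitt.LIIso E F,
      Leavitt.LIGradedIso E F,
      Nat.card E = Nat.card F] := by
  obtain ⟨G⟩ := Leavitt.nonempty_loopGraph hE hdE hlE
  obtain ⟨H⟩ := Leavitt.nonempty_loopGraph hF hdF hlF
  tfae_have 1 → 2 := fun ⟨φ, hφ, _⟩ => ⟨φ, hφ⟩
  tfae_have 2 → 5 := G.card_eq_of_lpaIso H
  tfae_have 4 → 3 := fun ⟨φ, _⟩ => ⟨φ⟩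
  tfae_have 3 → 5 := G.card_eq_of_liIso H
  tfae_have 5 → 1 := fun h => G.lpaGradedIso K H ((Finite.card_eq.1 h).some)
  tfae_have 5 → 4 := fun h => G.liGradedIso H ((Finite.card_eq.1 h).some)
  tfae_finish
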